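/- Fix an integer $s \ge 2$. For $n \ge s$, let $D_1, D_2, \dots$ be independent draws, each a uniformly random $s$-element subset of a set of $n$ coupons, and let $Y = Y_{n,s}$ be the number of draws needed to collect all $n$ coupons, i.e. the least $m$ such that $D_1 \cup \dots \cup D_m$ is the whole set of coupons. Then $E[Y] < \infty$ and $$E[Y] = \frac{n}{s} H_n - \frac{s-1}{2s} H_n + O(1) \qquad (n \to \infty),$$ where $H_n = \sum_{k=1}^{n} \frac1k$ is the $n$-th harmonic number and the implied constant depends only on $s$. -/

import Mathlib

open MeasureTheory ProbabilityTheory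
open scoped ENNReal

/-- The draws `D 0, D 1, D 2, …` are independent, and each of them is a uniformly random
`s`-element subset of the set `Fin n` of coupons. -/
structure IsUniformPackageProcess {Ω : Type*} [MeasurableSpace Ω] (μ : Measure Ω) {n : ℕ} (s : ℕ)
    (D : ℕ → Ω → Finset (Fin n)) : Prop where
  hasLaw : ∀ i, HasLaw (D i) (uniformOn {A : Finset (Fin n) | A.card = s}) μ
  indep : iIndepFun D μ

/-- The number of draws needed to collect all `n` coupons: the least `m` such that the union of
the first `m` draws is the set of all coupons (`⊤` if there is no such `m`). -/
noncomputable def collectionTime {Ω : Type*} {n : ℕ} (D : ℕ → Ω → Finset (Fin n)) (ω : Ω) : ℕ∞ :=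
  ⨅ (m : ℕ) (_ : (Finset.range m).biUnion (fun i => D i ω) = Finset.univ), (m : ℕ∞)

/-- The expected value of the number of draws needed to collect all `n` coupons, in `[0, ∞]`. -/
noncomputable def expectedCollectionTime {Ω : Type*} [MeasurableSpace Ω] (μ : Measure Ω) {n : ℕ}
    (D : ℕ → Ω → Finset (Fin n)) : ℝ≥0∞ :=
  ∫⁻ ω, (collectionTime D ω : ℝ≥0∞) ∂μ

/-! The missing coupons form a Markov chain M → M \ B, B a uniform `s`-subset, and E[Y] = Σ
P(missing set nonempty after m draws). By Dynkin's formula, a function G of the missing set whose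
expected one-step decrease is about 1 until absorption gives E[Y] ≈ G(all coupons).

Take G = H_{|M|} / c with c = H_n - H_{n-s}. Expanding H_k - H_{k-j} in the ratios C(j,r) / (r
C(k,r)) (`harmonic_sub_harmonic_sub`) makes the mean decrease of H_{|M|} equal to Σ_{1≤r≤|M|} q_r /
r, where q_r = C(s,r) / C(n,r). This is at most c, whence E[Y] ≥ H_n / c. The defect Σ_{r>|M|} q_r /
r is at most s c q_{|M|}, and q_{|M|} is the probability of finishing in the next draw; adding `s`
to G while coupons are missing absorbs it, whence E[Y] ≤ H_n / c + s.

Finally 1/c = n/s - (s-1)/(2s) + O(1/n), and H_n ≤ n keeps the error bounded. -/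

/-! ### Binomial expansion of harmonic differences -/

theorem sum_choose_div_choose {K j : ℕ} (hj : j ≤ K) :
    ∑ r ∈ Finset.range (K + 1), (j.choose r : ℝ) / K.choose r = (K + 1) / (K + 1 - j) := by
  induction K generalizing j with
  | zero => obtain rfl : j = 0 := by omega
            simp
  | succ K ih =>
    cases j with
    | zero =>
      rw [Finset.sum_range_succ']
      simp only [Nat.choose_zero_succ, Nat.choose_zero_right]
      have : ((K : ℝ) + 1 + 1) ≠ 0 := by positivity
      simp [this]
    | succ j =>
      have hj' : j ≤ K := by omega
      have key : ∀ r ∈ Finset.range (K + 1), ((j + 1).choose (r + 1) : ℝ) / (K + 1).choose (r + 1)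
          = (j + 1) / (K + 1) * ((j.choose r : ℝ) / K.choose r) := by
        intro r hr
        have h1 : ((j : ℝ) + 1) * j.choose r = (j + 1).choose (r + 1) * (r + 1) := by
          exact_mod_cast Nat.add_one_mul_choose_eq j r
        have h2 : ((K : ℝ) + 1) * K.choose r = (K + 1).choose (r + 1) * (r + 1) := by
          exact_mod_cast Nat.add_one_mul_choose_eq K r
        have h3 : (0 : ℝ) < K.choose r := by
          exact_mod_cast Nat.choose_pos (by simpa [Nat.lt_succ_iff] using hr)
        have h4 : (0 : ℝ) < (K + 1).choose (r + 1) := by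
          exact_mod_cast Nat.choose_pos (by simpa using Finset.mem_range.1 hr)
        have h5 : (0 : ℝ) < (r : ℝ) + 1 := by positivity
        rw [div_mul_div_comm, div_eq_div_iff h4.ne' (by positivity), h1, h2]
        ring
      rw [Finset.sum_range_succ', Finset.sum_congr rfl key, ← Finset.mul_sum, ih hj']
      have h6 : (0 : ℝ) < (K : ℝ) + 1 - j := by
        have : (j : ℝ) ≤ K := by exact_mod_cast hj'
        linarith
      have h7 : (K : ℝ) + 1 + 1 - (j + 1) = K + 1 - j := by ring
      push_cast
      rw [h7]
      simp only [Nat.choose_zero_right, Nat.cast_one, div_one]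
      field_simp
      ring

/-- Induction on `j`: by Pascal's rule the right side grows by Σ C(j,r) / C(k-1,r) / k, which
`sum_choose_div_choose` evaluates to 1/(k-j), the growth of the left side. -/
theorem harmonic_sub_harmonic_sub {k j : ℕ} (hj : j ≤ k) :
    (harmonic k : ℝ) - harmonic (k - j)
      = ∑ r ∈ Finset.range k, (j.choose (r + 1) : ℝ) / k.choose (r + 1) / (r + 1) := by
  induction j with
  | zero => simp
  | succ j ih =>
    obtain ⟨K, rfl⟩ : ∃ K, k = K + 1 := ⟨k - 1, by omega⟩
    have hK : j ≤ K := by omega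
    have e1 : K + 1 - j = (K - j) + 1 := by omega
    have e2 : K + 1 - (j + 1) = K - j := by omega
    have h0 := ih (by omega)
    rw [e1, harmonic_succ (K - j)] at h0
    have key : ∀ r ∈ Finset.range (K + 1),
        ((j + 1).choose (r + 1) : ℝ) / (K + 1).choose (r + 1) / (r + 1)
        = (j.choose (r + 1) : ℝ) / (K + 1).choose (r + 1) / (r + 1)
          + 1 / (K + 1) * ((j.choose r : ℝ) / K.choose r) := by
      intro r hr
      have h2 : ((K : ℝ) + 1) * K.choose r = (K + 1).choose (r + 1) * (r + 1) := by
        exact_mod_cast Nat.add_one_mul_choose_eq K r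
      have h3 : (0 : ℝ) < K.choose r := by
        exact_mod_cast Nat.choose_pos (by simpa [Nat.lt_succ_iff] using hr)
      rw [Nat.choose_succ_succ' j r, div_div, div_div, div_mul_div_comm, ← h2, ← add_div]
      push_cast
      ring
    rw [Finset.sum_congr rfl key, Finset.sum_add_distrib, ← Finset.mul_sum,
      sum_choose_div_choose hK, ← h0, e2]
    have h6 : (0 : ℝ) < (K : ℝ) - j + 1 := by
      have : (j : ℝ) ≤ K := by exact_mod_cast hK
      linarith
    have h7 : (K : ℝ) + 1 - j = K - j + 1 := by ring
    push_cast [Nat.cast_sub hK]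
    rw [h7]
    field_simp
    ring

/-! ### Averages over a uniform package -/

/-- The average of `F` over all `s`-element subsets of `Fin n`. -/
noncomputable def packageMean {n : ℕ} (s : ℕ) (F : Finset (Fin n) → ℝ) : ℝ :=
  (∑ B ∈ Finset.powersetCard s Finset.univ, F B) / n.choose s

/-- The probability that a uniformly random `s`-element subset of an `n`-element set contains
`r` given elements. -/
noncomputable def containProb (n s r : ℕ) : ℝ := (s.choose r : ℝ) / n.choose r

theorem containProb_nonneg (n s r : ℕ) : 0 ≤ containProb n s r := by
  unfold containProb; positivity

section packageMean

variable {n s : ℕ}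

theorem packageMean_const (hs : s ≤ n) (a : ℝ) :
    packageMean s (fun _ : Finset (Fin n) => a) = a := by
  have : (0 : ℝ) < n.choose s := by exact_mod_cast Nat.choose_pos hs
  simp [packageMean, Finset.card_powersetCard]
  field_simp

theorem packageMean_add (F G : Finset (Fin n) → ℝ) :
    packageMean s (fun B => F B + G B) = packageMean s F + packageMean s G := by
  simp [packageMean, Finset.sum_add_distrib, add_div]

theorem packageMean_sub (F G : Finset (Fin n) → ℝ) :
    packageMean s (fun B => F B - G B) = packageMean s F - packageMean s G := by
  simp [packageMean, Finset.sum_sub_distrib, sub_div]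

theorem packageMean_mul_const (F : Finset (Fin n) → ℝ) (a : ℝ) :
    packageMean s (fun B => F B * a) = packageMean s F * a := by
  simp [packageMean, ← Finset.sum_mul, div_mul_eq_mul_div]

theorem packageMean_sum {ι : Type*} (t : Finset ι) (F : ι → Finset (Fin n) → ℝ) :
    packageMean s (fun B => ∑ i ∈ t, F i B) = ∑ i ∈ t, packageMean s (F i) := by
  simp only [packageMean]
  rw [Finset.sum_comm, Finset.sum_div]

theorem packageMean_subset (hs : s ≤ n) (R : Finset (Fin n)) :
    packageMean s (fun B => if R ⊆ B then 1 else 0) = containProb n s R.card := by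
  have hR : R.card ≤ n := by simpa using R.card_le_univ
  have h1 : (0 : ℝ) < n.choose s := by exact_mod_cast Nat.choose_pos hs
  have h2 : (0 : ℝ) < n.choose R.card := by exact_mod_cast Nat.choose_pos hR
  rw [packageMean, containProb, div_eq_div_iff h1.ne' h2.ne', Finset.sum_boole]
  rcases le_or_gt R.card s with h | h
  · rw [Finset.card_filter_powersetCard_subset R _ s (Finset.subset_univ R) h]
    have := Nat.choose_mul (n := n) (k := s) (s := R.card) h
    simp only [Finset.card_univ, Fintype.card_fin]
    rw [mul_comm, mul_comm (s.choose _ : ℝ)]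
    exact_mod_cast this.symm
  · rw [Nat.choose_eq_zero_of_lt h, Finset.filter_false_of_mem]
    · simp
    · intro B hB hRB
      have := Finset.card_le_card hRB
      rw [(Finset.mem_powersetCard.1 hB).2] at this
      omega

/-- The binomial counts the `r`-subsets of `M` lying in `B`; each lies there with the same
probability. -/
theorem packageMean_choose_inter (hs : s ≤ n) (M : Finset (Fin n)) (r : ℕ) :
    packageMean s (fun B => ((M ∩ B).card.choose r : ℝ))
      = M.card.choose r * containProb n s r := by
  have h : ∀ B : Finset (Fin n), ((M ∩ B).card.choose r : ℝ)
      = ∑ R ∈ Finset.powersetCard r M, if R ⊆ B then (1 : ℝ) else 0 := by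
    intro B
    rw [Finset.sum_boole, ← Finset.card_powersetCard]
    congr 2
    ext R
    simp only [Finset.mem_powersetCard, Finset.subset_inter_iff, Finset.mem_filter]
    tauto
  simp_rw [h]
  rw [packageMean_sum, Finset.sum_congr rfl (fun R hR => by
    rw [packageMean_subset hs, (Finset.mem_powersetCard.1 hR).2])]
  simp

/-- The averaged binomials cancel the denominators C(|M|,r), so `M` enters only through the range of
summation. -/
theorem packageMean_harmonic_card_sdiff (hs : s ≤ n) (M : Finset (Fin n)) :
    (harmonic M.card : ℝ) - packageMean s (fun B => (harmonic (M \ B).card : ℝ))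
      = ∑ r ∈ Finset.range M.card, containProb n s (r + 1) / (r + 1) := by
  rw [← packageMean_const hs (harmonic M.card : ℝ), ← packageMean_sub]
  have h : ∀ B : Finset (Fin n), (harmonic M.card : ℝ) - harmonic (M \ B).card
      = ∑ r ∈ Finset.range M.card,
        ((M ∩ B).card.choose (r + 1) : ℝ) * ((M.card.choose (r + 1) : ℝ)⁻¹ * ((r : ℝ) + 1)⁻¹) := by
    intro B
    have e : (M \ B).card = M.card - (M ∩ B).card := by
      have := Finset.card_sdiff_add_card_inter M B
      omega
    rw [e, harmonic_sub_harmonic_sub (Finset.card_le_card Finset.inter_subset_left)]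
    simp only [div_eq_mul_inv, mul_assoc]
  simp_rw [h]
  rw [packageMean_sum]
  refine Finset.sum_congr rfl fun r hr => ?_
  have h1 : (0 : ℝ) < M.card.choose (r + 1) := by
    exact_mod_cast Nat.choose_pos (Finset.mem_range.1 hr)
  rw [packageMean_mul_const, packageMean_choose_inter hs]
  field_simp

theorem packageMean_nonempty_sdiff (hs : s ≤ n) (M : Finset (Fin n)) :
    packageMean s (fun B => if (M \ B).Nonempty then (1 : ℝ) else 0)
      = 1 - containProb n s M.card := by
  have h1 := packageMean_const hs (1 : ℝ)
  rw [← packageMean_subset hs, ← h1, ← packageMean_sub]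
  simp_rw [h1]
  congr 1
  ext B
  by_cases h : M ⊆ B
  · simp [h, Finset.sdiff_eq_empty_iff_subset.2 h]
  · simp [h, Finset.sdiff_nonempty]

end packageMean

/-! ### Decay of the containment probabilities -/

theorem containProb_succ_le {n s r : ℕ} (hs : s ≤ n) (hr : r < n) :
    containProb n s (r + 1) ≤ containProb n s r * (s / n) := by
  have h1 : (0 : ℝ) < n.choose r := by exact_mod_cast Nat.choose_pos hr.le
  have h2 : (0 : ℝ) < n.choose (r + 1) := by exact_mod_cast Nat.choose_pos hr
  have hn : (0 : ℝ) < n := by exact_mod_cast (by omega : 0 < n)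
  have hnr : (0 : ℝ) < (n : ℝ) - r := by
    have : (r : ℝ) < n := by exact_mod_cast hr
    linarith
  rcases le_or_gt s r with h | h
  · have : containProb n s (r + 1) = 0 := by
      simp [containProb, Nat.choose_eq_zero_of_lt (by omega : s < r + 1)]
    rw [this]
    exact mul_nonneg (containProb_nonneg _ _ _) (by positivity)
  · have e1 : (n.choose (r + 1) : ℝ) * (r + 1) = n.choose r * (n - r) := by
      rw [← Nat.cast_sub hr.le]
      exact_mod_cast Nat.choose_succ_right_eq n r
    have e2 : (s.choose (r + 1) : ℝ) * (r + 1) = s.choose r * (s - r) := by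
      rw [← Nat.cast_sub h.le]
      exact_mod_cast Nat.choose_succ_right_eq s r
    have hr1 : (0 : ℝ) < (r : ℝ) + 1 := by positivity
    have e3 : containProb n s (r + 1) = containProb n s r * ((s - r) / (n - r)) := by
      unfold containProb
      rw [div_mul_div_comm, ← e1, ← e2]
      field_simp
    rw [e3]
    refine mul_le_mul_of_nonneg_left ?_ (containProb_nonneg _ _ _)
    rw [div_le_div_iff₀ hnr hn]
    have : (s : ℝ) ≤ n := by exact_mod_cast hs
    nlinarith [mul_nonneg (Nat.cast_nonneg (α := ℝ) r) (sub_nonneg.2 this)]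

theorem containProb_antitone {n s k r : ℕ} (hs : s ≤ n) (hkr : k ≤ r) (hr : r ≤ n) :
    containProb n s r ≤ containProb n s k := by
  induction r, hkr using Nat.le_induction with
  | base => exact le_rfl
  | succ r hkr ih =>
    refine (containProb_succ_le hs (by omega)).trans (le_trans ?_ (ih (by omega)))
    refine mul_le_of_le_one_right (containProb_nonneg _ _ _) ?_
    exact div_le_one_of_le₀ (by exact_mod_cast hs) (by positivity)

theorem sum_containProb_eq {n s : ℕ} (hs : s ≤ n) :
    ∑ r ∈ Finset.range n, containProb n s (r + 1) / (r + 1)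
      = (harmonic n : ℝ) - harmonic (n - s) :=
  (harmonic_sub_harmonic_sub hs).symm

theorem div_le_harmonic_sub {n s : ℕ} (hs : s ≤ n) (hn : 0 < n) :
    (s : ℝ) / n ≤ (harmonic n : ℝ) - harmonic (n - s) := by
  rw [← sum_containProb_eq hs]
  have := Finset.single_le_sum (f := fun r : ℕ => containProb n s (r + 1) / ((r : ℝ) + 1))
    (fun r _ => div_nonneg (containProb_nonneg _ _ _) (by positivity)) (Finset.mem_range.2 hn)
  simpa [containProb] using this

/-- Terms with `r ≥ s` vanish, so at most `s` survive, each at most `containProb n s k * (s / n)`.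
-/
theorem sum_Ico_containProb_le {n s k : ℕ} (hs : s ≤ n) :
    ∑ r ∈ Finset.Ico k n, containProb n s (r + 1) / (r + 1)
      ≤ s * containProb n s k * (s / n) := by
  have hq := containProb_nonneg n s k
  have hsn : (0 : ℝ) ≤ s / n := by positivity
  calc ∑ r ∈ Finset.Ico k n, containProb n s (r + 1) / (r + 1)
      ≤ ∑ r ∈ Finset.Ico k n, if r ∈ Finset.range s then containProb n s k * (s / n) else 0 := by
        refine Finset.sum_le_sum fun r hr => ?_
        rw [Finset.mem_Ico] at hr
        split_ifs with h
        · refine (div_le_self (containProb_nonneg _ _ _) (by simp)).trans ?_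
          refine (containProb_succ_le hs hr.2).trans ?_
          exact mul_le_mul_of_nonneg_right (containProb_antitone hs hr.1 hr.2.le) hsn
        · rw [Finset.mem_range, not_lt] at h
          simp [containProb, Nat.choose_eq_zero_of_lt (by omega : s < r + 1)]
    _ = ∑ r ∈ (Finset.Ico k n).filter (· ∈ Finset.range s), containProb n s k * (s / n) := by
        rw [Finset.sum_filter]
    _ ≤ ∑ r ∈ Finset.range s, containProb n s k * (s / n) := by
        refine Finset.sum_le_sum_of_subset_of_nonneg ?_ fun _ _ _ => mul_nonneg hq hsn
        intro r hr
        exact (Finset.mem_filter.1 hr).2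
    _ = s * containProb n s k * (s / n) := by simp [mul_assoc]

/-! ### The chain of missing sets -/

/-- The set of coupons missing after the first `m` draws. -/
def missing {Ω : Type*} {n : ℕ} (D : ℕ → Ω → Finset (Fin n)) (m : ℕ) (ω : Ω) : Finset (Fin n) :=
  ((Finset.range m).biUnion fun i => D i ω)ᶜ

section missing

variable {Ω : Type*} {n : ℕ} (D : ℕ → Ω → Finset (Fin n))

theorem missing_zero (ω : Ω) : missing D 0 ω = Finset.univ := by simp [missing]

theorem missing_succ (m : ℕ) (ω : Ω) : missing D (m + 1) ω = missing D m ω \ D m ω := by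
  ext x
  simp only [missing, Finset.mem_compl, Finset.mem_biUnion, Finset.mem_range, Finset.mem_sdiff,
    Nat.lt_succ_iff_lt_or_eq]
  grind

theorem missing_antitone (ω : Ω) : Antitone fun m => missing D m ω :=
  antitone_nat_of_succ_le fun m => by rw [missing_succ]; exact Finset.sdiff_subset

/-- Missing sets decrease, so the times at which they are nonempty form an initial segment of ℕ, or
all of ℕ when both sides are infinite. -/
theorem collectionTime_eq_tsum (ω : Ω) :
    (collectionTime D ω : ℝ≥0∞)
      = ∑' m, if (missing D m ω).Nonempty then (1 : ℝ≥0∞) else 0 := by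
  have hiff : ∀ m, (Finset.range m).biUnion (fun i => D i ω) = Finset.univ
      ↔ ¬ (missing D m ω).Nonempty := by
    intro m
    simp [missing, Finset.not_nonempty_iff_eq_empty]
  unfold collectionTime
  simp only [hiff]
  by_cases h : ∃ m, ¬ (missing D m ω).Nonempty
  · classical
    have hspec := Nat.find_spec h
    have hlt : ∀ m, (missing D m ω).Nonempty ↔ m < Nat.find h := by
      intro m
      constructor
      · intro hm
        by_contra hc
        exact hspec (hm.mono (missing_antitone D ω (not_lt.1 hc)))
      · intro hm
        exact not_not.1 (Nat.find_min h hm)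
    have e1 : (⨅ (m : ℕ) (_ : ¬ (missing D m ω).Nonempty), (m : ℕ∞)) = (Nat.find h : ℕ∞) := by
      apply le_antisymm
      · exact iInf₂_le (f := fun (m : ℕ) (_ : ¬ (missing D m ω).Nonempty) => (m : ℕ∞)) _ hspec
      · refine le_iInf₂ fun m hm => ?_
        exact_mod_cast Nat.find_min' h hm
    rw [e1, tsum_eq_sum (s := Finset.range (Nat.find h))]
    · rw [Finset.sum_congr rfl fun m hm => if_pos ((hlt m).2 (Finset.mem_range.1 hm))]
      simp
    · intro m hm
      rw [if_neg]
      rw [hlt]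
      simpa using hm
  · push Not at h
    have h' : ∀ m, (missing D m ω).Nonempty := h
    simp [h']

end missing

/-! ### Dynkin's formula and drift criteria -/

section process

variable {Ω : Type*} [MeasurableSpace Ω] {μ : Measure Ω} {n s : ℕ}
  {D : ℕ → Ω → Finset (Fin n)}

theorem aemeasurable_missing (hD : IsUniformPackageProcess μ s D) (m : ℕ) :
    AEMeasurable (missing D m) μ := by
  induction m with
  | zero =>
    have : missing D 0 = fun _ => Finset.univ := funext (missing_zero D)
    rw [this]
    exact aemeasurable_const
  | succ m ih =>
    have : missing D (m + 1)
        = (fun p : Finset (Fin n) × Finset (Fin n) => p.1 \ p.2) ∘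
          fun ω => (missing D m ω, D m ω) := funext (missing_succ D m)
    rw [this]
    exact (Measurable.of_discrete).comp_aemeasurable (ih.prodMk (hD.hasLaw m).aemeasurable)

theorem indepFun_missing (hD : IsUniformPackageProcess μ s D) (m : ℕ) :
    IndepFun (missing D m) (D m) μ := by
  have h := hD.indep.indepFun_finset₀ (Finset.range m) {m} (by simp)
    fun i => (hD.hasLaw i).aemeasurable
  have h2 := h.comp
    (φ := fun t : (Finset.range m) → Finset (Fin n) => (Finset.univ.biUnion t)ᶜ)
    (ψ := fun t : ({m} : Finset ℕ) → Finset (Fin n) => t ⟨m, by simp⟩)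
    Measurable.of_discrete Measurable.of_discrete
  convert h2 using 1
  · ext ω x
    simp [missing]
  · rfl

theorem integrable_comp_missing [IsFiniteMeasure μ] (hD : IsUniformPackageProcess μ s D) (m : ℕ)
    (F : Finset (Fin n) → ℝ) : Integrable (fun ω => F (missing D m ω)) μ :=
  (Integrable.of_finite (μ := μ.map (missing D m)) (f := F)).comp_aemeasurable
    (aemeasurable_missing hD m)

theorem integral_missing_nonempty (hD : IsUniformPackageProcess μ s D) (m : ℕ) :
    ∫ ω, (if (missing D m ω).Nonempty then (1 : ℝ) else 0) ∂μ
      = μ.real {ω | (missing D m ω).Nonempty} := by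
  have hmeas : NullMeasurableSet {ω | (missing D m ω).Nonempty} μ :=
    (aemeasurable_missing hD m).nullMeasurableSet_preimage
      (MeasurableSet.of_discrete (s := {M : Finset (Fin n) | M.Nonempty}))
  have : (fun ω => if (missing D m ω).Nonempty then (1 : ℝ) else 0)
      = {ω | (missing D m ω).Nonempty}.indicator fun _ => 1 := by
    ext ω; simp [Set.indicator_apply]
  rw [this, integral_indicator₀ hmeas]
  simp

theorem integral_uniformOn_card_eq (hs : s ≤ n) (F : Finset (Fin n) → ℝ) :
    ∫ B, F B ∂(uniformOn {A : Finset (Fin n) | A.card = s}) = packageMean s F := by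
  have hset : {A : Finset (Fin n) | A.card = s}
      = ((Finset.powersetCard s Finset.univ : Finset (Finset (Fin n))) : Set _) := by
    ext A; simp
  have hc : (0 : ℝ) < n.choose s := by exact_mod_cast Nat.choose_pos hs
  have : IsFiniteMeasure (uniformOn {A : Finset (Fin n) | A.card = s}) := inferInstance
  rw [integral_fintype Integrable.of_finite, packageMean, Finset.sum_div,
    ← Finset.sum_subset (Finset.subset_univ (Finset.powersetCard s Finset.univ))]
  · refine Finset.sum_congr rfl fun B hB => ?_
    rw [hset, measureReal_def, ← Finset.coe_singleton, uniformOn_apply_finset,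
      Finset.inter_singleton_of_mem hB]
    simp [div_eq_inv_mul]
  · intro B _ hB
    rw [hset, measureReal_def, ← Finset.coe_singleton, uniformOn_apply_finset,
      Finset.inter_singleton_of_notMem hB]
    simp

variable [IsProbabilityMeasure μ]

theorem integral_missing_succ (hs : s ≤ n) (hD : IsUniformPackageProcess μ s D) (m : ℕ)
    (F : Finset (Fin n) → ℝ) :
    ∫ ω, F (missing D (m + 1) ω) ∂μ
      = ∫ ω, packageMean s (fun B => F (missing D m ω \ B)) ∂μ := by
  have hM := aemeasurable_missing hD m
  have hDm := (hD.hasLaw m).aemeasurable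
  have : IsProbabilityMeasure (μ.map (missing D m)) := Measure.isProbabilityMeasure_map hM
  have : IsProbabilityMeasure (μ.map (D m)) := Measure.isProbabilityMeasure_map hDm
  have hmap := (indepFun_iff_map_prod_eq_prod_map_map hM hDm).1 (indepFun_missing hD m)
  simp_rw [missing_succ]
  rw [← integral_map (φ := fun ω => (missing D m ω, D m ω)) (f := fun p => F (p.1 \ p.2))
    (hM.prodMk hDm) (Measurable.of_discrete.aestronglyMeasurable), hmap,
    integral_prod _ Integrable.of_finite,
    integral_map hM (Measurable.of_discrete.aestronglyMeasurable)]
  simp_rw [(hD.hasLaw m).map_eq, integral_uniformOn_card_eq hs]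

/-- Dynkin's formula for the chain of missing sets. -/
theorem sum_integral_drift (hs : s ≤ n) (hD : IsUniformPackageProcess μ s D)
    (G : Finset (Fin n) → ℝ) (N : ℕ) :
    ∑ m ∈ Finset.range N,
        ∫ ω, (G (missing D m ω) - packageMean s fun B => G (missing D m ω \ B)) ∂μ
      = G Finset.univ - ∫ ω, G (missing D N ω) ∂μ := by
  have h : ∀ m, ∫ ω, (G (missing D m ω) - packageMean s fun B => G (missing D m ω \ B)) ∂μ
      = ∫ ω, G (missing D m ω) ∂μ - ∫ ω, G (missing D (m + 1) ω) ∂μ := by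
    intro m
    rw [integral_missing_succ hs hD, integral_sub (integrable_comp_missing hD m G)
      (integrable_comp_missing hD m fun M => packageMean s fun B => G (M \ B))]
  simp_rw [h]
  rw [Finset.sum_range_sub']
  simp [missing_zero]

theorem expectedCollectionTime_eq_tsum (hD : IsUniformPackageProcess μ s D) :
    expectedCollectionTime μ D
      = ∑' m, ENNReal.ofReal (μ.real {ω | (missing D m ω).Nonempty}) := by
  unfold expectedCollectionTime
  simp_rw [collectionTime_eq_tsum]
  rw [lintegral_tsum (f := fun m ω => if (missing D m ω).Nonempty then (1 : ℝ≥0∞) else 0)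
    fun m => (Measurable.of_discrete
      (f := fun M : Finset (Fin n) => if M.Nonempty then (1 : ℝ≥0∞) else 0)).comp_aemeasurable
        (aemeasurable_missing hD m)]
  congr 1
  ext m
  have hmeas : NullMeasurableSet {ω | (missing D m ω).Nonempty} μ :=
    (aemeasurable_missing hD m).nullMeasurableSet_preimage
      (MeasurableSet.of_discrete (s := {M : Finset (Fin n) | M.Nonempty}))
  have : (fun ω => if (missing D m ω).Nonempty then (1 : ℝ≥0∞) else 0)
      = {ω | (missing D m ω).Nonempty}.indicator fun _ => 1 := by
    ext ω; simp [Set.indicator_apply]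
  rw [this, lintegral_indicator₀ hmeas]
  simp [ofReal_measureReal]

theorem summable_and_tsum_le_of_drift (hs : s ≤ n) (hD : IsUniformPackageProcess μ s D)
    {G : Finset (Fin n) → ℝ} (hG0 : ∀ M, 0 ≤ G M)
    (hG : ∀ M, (if M.Nonempty then 1 else 0) ≤ G M - packageMean s fun B => G (M \ B)) :
    (Summable fun m => μ.real {ω | (missing D m ω).Nonempty}) ∧
      ∑' m, μ.real {ω | (missing D m ω).Nonempty} ≤ G Finset.univ := by
  have hle : ∀ N, ∑ m ∈ Finset.range N, μ.real {ω | (missing D m ω).Nonempty}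
      ≤ G Finset.univ := by
    intro N
    calc ∑ m ∈ Finset.range N, μ.real {ω | (missing D m ω).Nonempty}
        ≤ ∑ m ∈ Finset.range N,
          ∫ ω, (G (missing D m ω) - packageMean s fun B => G (missing D m ω \ B)) ∂μ := by
          refine Finset.sum_le_sum fun m _ => ?_
          rw [← integral_missing_nonempty hD]
          exact integral_mono
            (integrable_comp_missing hD m fun M => if M.Nonempty then (1 : ℝ) else 0)
            (integrable_comp_missing hD m fun M => G M - packageMean s fun B => G (M \ B))
            fun ω => hG _
      _ = G Finset.univ - ∫ ω, G (missing D N ω) ∂μ := sum_integral_drift hs hD G N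
      _ ≤ G Finset.univ := sub_le_self _ (integral_nonneg fun ω => hG0 _)
  exact ⟨summable_of_sum_range_le (fun _ => measureReal_nonneg) hle,
    Real.tsum_le_of_sum_range_le (fun _ => measureReal_nonneg) hle⟩

/-- The bound `hGb` controls the boundary term of Dynkin's formula by a multiple of the probability
of being unfinished, which tends to 0 by summability. -/
theorem le_tsum_of_drift (hs : s ≤ n) (hD : IsUniformPackageProcess μ s D)
    (hsum : Summable fun m => μ.real {ω | (missing D m ω).Nonempty})
    {G : Finset (Fin n) → ℝ} (hGb : ∀ M, G M ≤ if M.Nonempty then G Finset.univ else 0)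
    (hG : ∀ M, (G M - packageMean s fun B => G (M \ B)) ≤ if M.Nonempty then 1 else 0) :
    G Finset.univ ≤ ∑' m, μ.real {ω | (missing D m ω).Nonempty} := by
  have hle : ∀ N, G Finset.univ ≤
      ∑ m ∈ Finset.range N, μ.real {ω | (missing D m ω).Nonempty}
        + G Finset.univ * μ.real {ω | (missing D N ω).Nonempty} := by
    intro N
    have h1 : ∑ m ∈ Finset.range N,
          ∫ ω, (G (missing D m ω) - packageMean s fun B => G (missing D m ω \ B)) ∂μ
        ≤ ∑ m ∈ Finset.range N, μ.real {ω | (missing D m ω).Nonempty} := by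
      refine Finset.sum_le_sum fun m _ => ?_
      rw [← integral_missing_nonempty hD]
      exact integral_mono
        (integrable_comp_missing hD m fun M => G M - packageMean s fun B => G (M \ B))
        (integrable_comp_missing hD m fun M => if M.Nonempty then (1 : ℝ) else 0)
        fun ω => hG _
    have h2 : ∫ ω, G (missing D N ω) ∂μ
        ≤ G Finset.univ * μ.real {ω | (missing D N ω).Nonempty} := by
      rw [← integral_missing_nonempty hD, ← integral_const_mul]
      refine integral_mono (integrable_comp_missing hD N G)
        (integrable_comp_missing hD N
          fun M => G Finset.univ * if M.Nonempty then (1 : ℝ) else 0) fun ω => ?_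
      simpa using hGb (missing D N ω)
    rw [sum_integral_drift hs hD G N] at h1
    linarith
  have hlim := hsum.hasSum.tendsto_sum_nat.add (hsum.tendsto_atTop_zero.const_mul (G Finset.univ))
  rw [mul_zero, add_zero] at hlim
  exact ge_of_tendsto' hlim hle

end process

/-! ### Harmonic potentials and two-sided bounds -/

theorem harmonic_cast_mono : Monotone fun n => (harmonic n : ℝ) :=
  monotone_nat_of_le_succ fun n => by
    rw [harmonic_succ]
    push_cast
    have : (0 : ℝ) ≤ ((n : ℝ) + 1)⁻¹ := by positivity
    linarith

theorem harmonic_cast_nonneg (n : ℕ) : (0 : ℝ) ≤ harmonic n := by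
  simpa using harmonic_cast_mono (Nat.zero_le n)

theorem harmonic_cast_le (n : ℕ) : (harmonic n : ℝ) ≤ n := by
  induction n with
  | zero => simp
  | succ n ih =>
    rw [harmonic_succ]
    push_cast
    have : ((n : ℝ) + 1)⁻¹ ≤ 1 := inv_le_one_of_one_le₀ (by simp)
    linarith

section bounds

variable {n s : ℕ}

theorem drift_harmonic_le (hs0 : 0 < s) (hs : s ≤ n) (M : Finset (Fin n)) :
    ((harmonic M.card : ℝ) / (harmonic n - harmonic (n - s))
      - packageMean s fun B => (harmonic (M \ B).card : ℝ) / (harmonic n - harmonic (n - s)))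
      ≤ if M.Nonempty then 1 else 0 := by
  have hn : 0 < n := by omega
  have hc : (0 : ℝ) < (harmonic n : ℝ) - harmonic (n - s) :=
    lt_of_lt_of_le (by positivity) (div_le_harmonic_sub hs hn)
  have hM : M.card ≤ n := by simpa using M.card_le_univ
  simp only [div_eq_mul_inv]
  rw [packageMean_mul_const, ← sub_mul, packageMean_harmonic_card_sdiff hs, ← div_eq_mul_inv]
  split_ifs with h
  · rw [div_le_one hc, ← sum_containProb_eq hs]
    exact Finset.sum_le_sum_of_subset_of_nonneg (Finset.range_mono hM)
      fun r _ _ => div_nonneg (containProb_nonneg _ _ _) (by positivity)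
  · simp [Finset.not_nonempty_iff_eq_empty.1 h]

theorem le_drift_harmonic_add (hs0 : 0 < s) (hs : s ≤ n) (M : Finset (Fin n)) :
    (if M.Nonempty then 1 else 0) ≤
      ((harmonic M.card : ℝ) / (harmonic n - harmonic (n - s)) + if M.Nonempty then (s : ℝ) else 0)
      - packageMean s fun B => (harmonic (M \ B).card : ℝ) / (harmonic n - harmonic (n - s))
        + if (M \ B).Nonempty then (s : ℝ) else 0 := by
  have hn : 0 < n := by omega
  have hn' : (0 : ℝ) < n := by exact_mod_cast hn
  have hcs := div_le_harmonic_sub hs hn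
  have hc : (0 : ℝ) < (harmonic n : ℝ) - harmonic (n - s) :=
    lt_of_lt_of_le (by positivity) hcs
  have hM : M.card ≤ n := by simpa using M.card_le_univ
  have hite : ∀ M : Finset (Fin n), (if M.Nonempty then (s : ℝ) else 0)
      = (if M.Nonempty then (1 : ℝ) else 0) * s := by intro M; simp
  rw [packageMean_add]
  simp only [div_eq_mul_inv, hite]
  rw [packageMean_mul_const, packageMean_mul_const, packageMean_nonempty_sdiff hs]
  have hd := packageMean_harmonic_card_sdiff hs M
  set P := packageMean s fun B => (harmonic (M \ B).card : ℝ)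
  set c := (harmonic n : ℝ) - harmonic (n - s)
  split_ifs with h
  · have hsplit := Finset.sum_range_add_sum_Ico
      (fun r : ℕ => containProb n s (r + 1) / ((r : ℝ) + 1)) hM
    rw [sum_containProb_eq hs, ← hd] at hsplit
    have htail := sum_Ico_containProb_le (n := n) (s := s) (k := M.card) hs
    have h1 : s * containProb n s M.card * (s / n) ≤ s * containProb n s M.card * c :=
      mul_le_mul_of_nonneg_left hcs (mul_nonneg (by positivity) (containProb_nonneg _ _ _))
    -- Divided by `c`, the last term is exactly the expected decrease of the added term `s * 1[M
    -- nonempty]`.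
    have h2 : c ≤ (harmonic M.card - P) + s * containProb n s M.card * c := by
      have : c = (harmonic M.card - P) + _ := hsplit.symm
      linarith
    have h3 : (1 : ℝ) ≤ ((harmonic M.card - P) + s * containProb n s M.card * c) * c⁻¹ := by
      rw [← div_eq_mul_inv, le_div_iff₀ hc, one_mul]
      exact h2
    have h4 : ((harmonic M.card - P) + s * containProb n s M.card * c) * c⁻¹
        = (harmonic M.card - P) * c⁻¹ + s * containProb n s M.card := by
      field_simp
    linarith
  · rw [Finset.not_nonempty_iff_eq_empty] at h
    have h5 : P = 0 := by simpa [h] using hd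
    rw [h5]
    simp [h, containProb]

theorem expectedCollectionTime_bounds {Ω : Type*} [MeasurableSpace Ω] {μ : Measure Ω}
    [IsProbabilityMeasure μ] {D : ℕ → Ω → Finset (Fin n)} (hs0 : 0 < s) (hs : s ≤ n)
    (hD : IsUniformPackageProcess μ s D) :
    expectedCollectionTime μ D ≠ ∞ ∧
      (harmonic n : ℝ) / (harmonic n - harmonic (n - s)) ≤ (expectedCollectionTime μ D).toReal ∧
      (expectedCollectionTime μ D).toReal ≤
        (harmonic n : ℝ) / (harmonic n - harmonic (n - s)) + s := by
  have hn : 0 < n := by omega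
  have hc : (0 : ℝ) < (harmonic n : ℝ) - harmonic (n - s) :=
    lt_of_lt_of_le (by positivity) (div_le_harmonic_sub hs hn)
  obtain ⟨hsum, hub⟩ := summable_and_tsum_le_of_drift hs hD
    (G := fun M => (harmonic M.card : ℝ) / (harmonic n - harmonic (n - s))
      + if M.Nonempty then (s : ℝ) else 0)
    (fun M => add_nonneg (div_nonneg (harmonic_cast_nonneg _) hc.le) (by split_ifs <;> simp))
    (le_drift_harmonic_add hs0 hs)
  have hlb := le_tsum_of_drift hs hD hsum
    (G := fun M => (harmonic M.card : ℝ) / (harmonic n - harmonic (n - s)))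
    (fun M => by
      split_ifs with h
      · exact div_le_div_of_nonneg_right (harmonic_cast_mono M.card_le_univ) hc.le
      · simp [Finset.not_nonempty_iff_eq_empty.1 h])
    (drift_harmonic_le hs0 hs)
  have hne : (Finset.univ : Finset (Fin n)).Nonempty := ⟨⟨0, hn⟩, Finset.mem_univ _⟩
  simp only [Finset.card_univ, Fintype.card_fin, hne, if_true] at hub hlb
  have heq : expectedCollectionTime μ D
      = ENNReal.ofReal (∑' m, μ.real {ω | (missing D m ω).Nonempty}) := by
    rw [expectedCollectionTime_eq_tsum hD,
      ENNReal.ofReal_tsum_of_nonneg (fun _ => measureReal_nonneg) hsum]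
  have htr : (expectedCollectionTime μ D).toReal
      = ∑' m, μ.real {ω | (missing D m ω).Nonempty} := by
    rw [heq, ENNReal.toReal_ofReal (tsum_nonneg fun _ => measureReal_nonneg)]
  rw [htr]
  exact ⟨by rw [heq]; exact ENNReal.ofReal_ne_top, hlb, hub⟩

/-! ### Asymptotics of the normalising constant -/

theorem harmonic_sub_eq_sum (hs : s ≤ n) :
    (harmonic n : ℝ) - harmonic (n - s) = ∑ i ∈ Finset.range s, 1 / ((n : ℝ) - i) := by
  induction s with
  | zero => simp
  | succ s ih =>
    have e : n - s = (n - (s + 1)) + 1 := by omega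
    rw [Finset.sum_range_succ, ← ih (by omega), e, harmonic_succ]
    push_cast [Nat.cast_sub hs]
    have : (n : ℝ) - (s + 1) + 1 = n - s := by ring
    rw [this]
    ring

theorem abs_inv_harmonic_sub_sub_le (hs0 : 0 < s) (hn : 2 * s ≤ n) :
    |1 / ((harmonic n : ℝ) - harmonic (n - s)) - ((n : ℝ) / s - ((s : ℝ) - 1) / (2 * s))|
      ≤ 2 * s / n := by
  have hs : s ≤ n := by omega
  have hn0 : (0 : ℝ) < n := by exact_mod_cast (by omega : 0 < n)
  have hs0' : (0 : ℝ) < s := by exact_mod_cast hs0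
  have hn' : 2 * (s : ℝ) ≤ n := by exact_mod_cast hn
  have hcs := div_le_harmonic_sub hs (by omega : 0 < n)
  have hsum := harmonic_sub_eq_sum hs
  set c := (harmonic n : ℝ) - harmonic (n - s)
  have hc : 0 < c := lt_of_lt_of_le (by positivity) hcs
  have hgauss : ∑ i ∈ Finset.range s, ((i : ℝ) - ((s : ℝ) - 1) / 2) = 0 := by
    have h : ∀ t : ℕ, ∑ i ∈ Finset.range t, (i : ℝ) = t * ((t : ℝ) - 1) / 2 := by
      intro t
      induction t with
      | zero => simp
      | succ t ih => rw [Finset.sum_range_succ, ih]; push_cast; ring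
    rw [Finset.sum_sub_distrib, h]
    simp
    ring
  -- Write 1/(n-i) = 1/n + i/(n(n-i)): the 1/n part cancels because the weights i - (s-1)/2 sum to
  -- zero, leaving O(1/n²).
  have hid : c * ((n : ℝ) / s - ((s : ℝ) - 1) / (2 * s)) - 1
      = (1 / s) * ∑ i ∈ Finset.range s,
          ((i : ℝ) - ((s : ℝ) - 1) / 2) * i / (n * (n - i)) := by
    have hterm : ∀ i ∈ Finset.range s, ((i : ℝ) - ((s : ℝ) - 1) / 2) * i / (n * (n - i))
        = (1 / ((n : ℝ) - i)) * (n - (s - 1) / 2) - 1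
          - ((i : ℝ) - ((s : ℝ) - 1) / 2) * (1 / n) := by
      intro i hi
      have hi' : (i : ℝ) < s := by exact_mod_cast Finset.mem_range.1 hi
      have : (0 : ℝ) < n - i := by linarith
      field_simp
      ring
    rw [Finset.sum_congr rfl hterm, Finset.sum_sub_distrib, Finset.sum_sub_distrib,
      ← Finset.sum_mul, ← Finset.sum_mul, hgauss, ← hsum]
    simp
    field_simp
  have hbound : |∑ i ∈ Finset.range s, ((i : ℝ) - ((s : ℝ) - 1) / 2) * i / (n * (n - i))|
      ≤ s * (s * s / (n * (n / 2))) := by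
    refine (Finset.abs_sum_le_sum_abs _ _).trans ?_
    have hcard : ∑ _i ∈ Finset.range s, ((s : ℝ) * s / (n * (n / 2)))
        = s * (s * s / (n * (n / 2))) := by simp
    rw [← hcard]
    refine Finset.sum_le_sum fun i hi => ?_
    have hi' : (i : ℝ) + 1 ≤ s := by exact_mod_cast Finset.mem_range.1 hi
    have hi0 : (0 : ℝ) ≤ i := by positivity
    have h1 : (n : ℝ) / 2 ≤ n - i := by linarith
    have h2 : (0 : ℝ) < n - i := by linarith
    rw [abs_div, abs_mul, abs_of_pos (mul_pos hn0 h2), abs_of_nonneg hi0]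
    have h3 : |(i : ℝ) - ((s : ℝ) - 1) / 2| ≤ s := by
      rw [abs_le]; constructor <;> linarith
    gcongr
    exact (Finset.mem_range.1 hi).le
  have hid2 : 1 / c - ((n : ℝ) / s - ((s : ℝ) - 1) / (2 * s))
      = -((1 / c) * ((1 / s) * ∑ i ∈ Finset.range s,
          ((i : ℝ) - ((s : ℝ) - 1) / 2) * i / (n * (n - i)))) := by
    rw [← hid]
    field_simp
    ring
  rw [hid2, abs_neg, abs_mul, abs_mul, abs_of_pos (one_div_pos.2 hc),
    abs_of_pos (one_div_pos.2 hs0')]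
  have hcinv : 1 / c ≤ n / s := by
    rw [one_div, ← inv_div]
    exact inv_anti₀ (by positivity) hcs
  calc 1 / c * (1 / s * |∑ i ∈ Finset.range s, ((i : ℝ) - ((s : ℝ) - 1) / 2) * i / (n * (n - i))|)
      ≤ n / s * (1 / s * (s * (s * s / (n * (n / 2))))) := by gcongr
    _ = 2 * s / n := by field_simp

end bounds

theorem theorem1 (s : ℕ) (hs : 2 ≤ s) :
    ∃ (C : ℝ) (N : ℕ), ∀ n : ℕ, N ≤ n →
      ∀ {Ω : Type*} [MeasurableSpace Ω] (μ : Measure Ω) [IsProbabilityMeasure μ]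
        (D : ℕ → Ω → Finset (Fin n)), IsUniformPackageProcess μ s D →
        expectedCollectionTime μ D ≠ ∞ ∧
        |(expectedCollectionTime μ D).toReal -
          ((n : ℝ) / s * (harmonic n : ℝ) - ((s : ℝ) - 1) / (2 * s) * (harmonic n : ℝ))| ≤ C := by
  -- The constant is `s` from the gap between the two bounds plus `2 * s` from expanding 1/c; `n ≥ 2
  -- * s` gives n - i ≥ n/2 for i < s.
  refine ⟨3 * s, 2 * s, fun n hn Ω _ μ _ D hD => ?_⟩
  obtain ⟨hfin, hlb, hub⟩ := expectedCollectionTime_bounds (by omega) (by omega) hD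
  refine ⟨hfin, ?_⟩
  have hn0 : (0 : ℝ) < n := by exact_mod_cast (by omega : 0 < n)
  have hH0 := harmonic_cast_nonneg n
  have h1 := abs_inv_harmonic_sub_sub_le (by omega : 0 < s) hn
  have h2 : |(harmonic n : ℝ) / (harmonic n - harmonic (n - s))
      - ((n : ℝ) / s * (harmonic n : ℝ) - ((s : ℝ) - 1) / (2 * s) * (harmonic n : ℝ))|
      ≤ 2 * s := by
    calc _ = |1 / ((harmonic n : ℝ) - harmonic (n - s))
          - ((n : ℝ) / s - ((s : ℝ) - 1) / (2 * s))| * harmonic n := by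
          rw [← abs_of_nonneg hH0, ← abs_mul, abs_of_nonneg hH0]
          congr 1
          ring
      _ ≤ 2 * s / n * n := by
          gcongr
          exact harmonic_cast_le n
      _ = 2 * s := by field_simp
  rw [abs_le] at h2 ⊢
  constructor <;> linarith [h2.1, h2.2, (Nat.cast_nonneg s : (0 : ℝ) ≤ s)]
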